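/- Let $d\in\mathbb N$ and $0<\epsilon<d/2$. For $s\in[\epsilon,d-\epsilon]$, an integer $N\ge 0$ and a Borel probability measure $\mu$ on $\mathbb R^d$ put $$F_{N,s}(\mu)=\inf_{\gamma}\int_{(\mathbb R^d)^N}\sum_{1\le i\ne j\le N}|x_i-x_j|^{-s}\,d\gamma(x_1,\dots,x_N),\qquad E^{\mathrm{xc}}_{N,s}(\mu)=F_{N,s}(\mu)-N^2\iint|x-y|^{-s}\,d\mu(x)\,d\mu(y),$$ where $\gamma$ ranges over the Borel probability measures on $(\mathbb R^d)^N$ that are invariant under permutations of the $N$ coordinates and have all their $\mathbb R^d$-marginals equal to $\mu$, the sum is over ordered pairs, and $|x-y|^{-s}=+\infty$ if $x=y$; thus $F_{0,s}=F_{1,s}=0$. For real $N\ge 2$ put $$F_{\mathrm{GC},N,s}(\mu)=\inf\Big\{\sum_{n=2}^\infty\alpha_nF_{n,s}(\mu_n):\ \alpha_n\ge 0,\ \mu_n\text{ Borel probability measures on }\mathbb R^d,\ \sum_{n=0}^\infty\alpha_n=1,\ \sum_{n=1}^\infty n\alpha_n\mu_n=N\mu\Big\},$$ $$E^{\mathrm{xc}}_{\mathrm{GC},N,s}(\mu)=F_{\mathrm{GC},N,s}(\mu)-N^2\iint|x-y|^{-s}\,d\mu(x)\,d\mu(y).$$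 Then there is a constant $-\infty<c_{\mathrm{LO}}(d,\epsilon)<0$, depending only on $d$ and $\epsilon$, such that for every $s\in[\epsilon,d-\epsilon]$ and every Borel probability measure $\mu$ on $\mathbb R^d$ with a density $\rho\in L^{1+s/d}(\mathbb R^d)$, these energies are finite and $$c_{\mathrm{LO}}(d,\epsilon)\int_{\mathbb R^d}\rho^{1+\frac sd}(x)\,dx\ \le\ N^{-1-\frac sd}E^{\mathrm{xc}}_{N,s}(\mu)\ \le\ 0\quad\text{for all integers }N\ge 2,$$ $$c_{\mathrm{LO}}(d,\epsilon)\int_{\mathbb R^d}\rho^{1+\frac sd}(x)\,dx\ \le\ N^{-1-\frac sd}E^{\mathrm{xc}}_{\mathrm{GC},N,s}(\mu)\ \le\ 0\quad\text{for all real }N\ge 2.$$ -/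

import Mathlib

open MeasureTheory
open scoped ENNReal

namespace RieszOT

noncomputable section

variable {X : Type*} [MeasurableSpace X]

/-- The admissible plans: Borel probability measures on `X^N` that are invariant under all
permutations of the `N` coordinates and all of whose one-body marginals equal `μ`. -/
def symPlans (N : ℕ) (μ : Measure X) : Set (Measure (Fin N → X)) :=
  {γ | IsProbabilityMeasure γ ∧
    (∀ σ : Equiv.Perm (Fin N), γ.map (fun x i => x (σ i)) = γ) ∧
    ∀ i : Fin N, γ.map (fun x => x i) = μ}

/-- The `N`-marginal optimal transport cost: the infimum over admissible plans of the integral of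
`∑_{i ≠ j} c (x_i, x_j)` over ordered pairs. (For `N = 0, 1` the sum is empty and the value is
`0` for every probability measure.) -/
def otCost (c : X → X → ℝ≥0∞) (N : ℕ) (μ : Measure X) : ℝ≥0∞ :=
  ⨅ γ ∈ symPlans N μ,
    ∫⁻ x, ∑ p ∈ (Finset.univ : Finset (Fin N)).offDiag, c (x p.1) (x p.2) ∂γ

/-- The pairs of a weight sequence `α` and a sequence `ν` of probability measures with
`∑_{n ≥ 0} α_n = 1` and `∑_{n ≥ 1} n α_n ν_n = N μ`
(the `n = 0` term of the second sum is zero). -/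
def gcCompetitors (N : ℝ) (μ : Measure X) : Set ((ℕ → ℝ≥0∞) × (ℕ → Measure X)) :=
  {p | (∀ n, IsProbabilityMeasure (p.2 n)) ∧ ∑' n, p.1 n = 1 ∧
    Measure.sum (fun n : ℕ => ((n : ℝ≥0∞) * p.1 n) • p.2 n) = ENNReal.ofReal N • μ}

/-- The grand-canonical optimal transport cost: the infimum of `∑_{n ≥ 2} α_n F_n(ν_n)`. -/
def gcCost (c : X → X → ℝ≥0∞) (N : ℝ) (μ : Measure X) : ℝ≥0∞ :=
  ⨅ p ∈ gcCompetitors N μ, ∑' n : ℕ, p.1 (n + 2) * otCost c (n + 2) (p.2 (n + 2))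

/-- The mean-field energy `∬ c(x, y) dμ(x) dμ(y)`. -/
def meanField (c : X → X → ℝ≥0∞) (μ : Measure X) : ℝ≥0∞ :=
  ∫⁻ x, ∫⁻ y, c x y ∂μ ∂μ

/-- The exchange-correlation energy, as an extended real number.
It is `⊥` when the mean-field energy is infinite and `N ≠ 0`. -/
def exc (c : X → X → ℝ≥0∞) (N : ℕ) (μ : Measure X) : EReal :=
  (otCost c N μ : EReal) - (((N : ℝ≥0∞) ^ 2 * meanField c μ : ℝ≥0∞) : EReal)

/-- The grand-canonical exchange-correlation energy, as an extended real number. -/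
def gcExc (c : X → X → ℝ≥0∞) (N : ℝ) (μ : Measure X) : EReal :=
  (gcCost c N μ : EReal) - ((ENNReal.ofReal N ^ 2 * meanField c μ : ℝ≥0∞) : EReal)

/-- The cost `|x - y|^{-s}` on `ℝ^d` with the Euclidean distance; for `s > 0` it is `∞` at
`x = y`. -/
def rieszCost (d : ℕ) (s : ℝ) (x y : EuclideanSpace ℝ (Fin d)) : ℝ≥0∞ :=
  edist x y ^ (-s)

end

end RieszOT

namespace RieszOT

/-! ### Costs that are superpositions of pair products: trial plans and the tangent-line lower
bound. -/

section Abstract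

variable {X : Type*} [MeasurableSpace X]

/-! The upper bounds come from trial states: the product plan (`otCost_le`), and for real `N` a
mixture of product plans with the two neighbouring particle numbers (`gcCost_le`).

The lower bound rests on the Fefferman–de la Llave formula (`ballKernel_eq_mul_edist_rpow`): up to a
factor, the Riesz kernel is the integral over all balls of the product of the ball's indicator at
`x` and at `y`. For one ball, let `n` be the random number of particles in it and `m` its mean. The
mean-field energy contributes `m²`, the true energy the mean of `n(n - 1)`. Since `n² ≥ 2mn - m²`,
the latter is at least `m² - m`, and it is nonnegative, so the deficit is at most `min(m, m²)`
(`sq_mul_meanField_le_gcCost_add`). Only the mean of `n` enters, so the argument is grand-canonical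
from the start, and the canonical bound follows from `gcCost_le_otCost`.

It remains to integrate `min(m, m²)` over balls (`lintegral_min_scaleMeasure_le`). At radius `r` the
density is cut at height `r^(-d)`. The part above the cut is estimated linearly, the part below by
Cauchy–Schwarz, and integrating over `r` turns both into the integral of the density to the power `1
+ s/d`. Uniformity in `s` comes from a lower bound on the normalising factor
(`inv_ballKernel_mul_le`). -/

theorem pi_mem_symPlans (N : ℕ) (μ : Measure X) [IsProbabilityMeasure μ] :
    Measure.pi (fun _ : Fin N => μ) ∈ symPlans N μ := by
  refine ⟨inferInstance, fun σ => ?_, fun i => ?_⟩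
  · have h := (measurePreserving_piCongrLeft (fun _ : Fin N => μ) σ.symm).map_eq
    convert h using 2
    ext x i
    simp [MeasurableEquiv.piCongrLeft, Equiv.piCongrLeft, Equiv.piCongrLeft']
  · exact (measurePreserving_eval (fun _ : Fin N => μ) i).map_eq

theorem lintegral_pi_pair {c : X → X → ℝ≥0∞} (hc : Measurable (Function.uncurry c)) {N : ℕ}
    (μ : Measure X) [IsProbabilityMeasure μ] {i j : Fin N} (hij : i ≠ j) :
    ∫⁻ x, c (x i) (x j) ∂(Measure.pi fun _ : Fin N => μ) = meanField c μ := by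
  have hind := (ProbabilityTheory.iIndepFun_pi (μ := fun _ : Fin N => μ)
    (X := fun _ x => x) (fun _ => aemeasurable_id)).indepFun hij
  have h := (ProbabilityTheory.indepFun_iff_map_prod_eq_prod_map_map
    (measurable_pi_apply i).aemeasurable (measurable_pi_apply j).aemeasurable).1 hind
  rw [(measurePreserving_eval (fun _ : Fin N => μ) i).map_eq,
    (measurePreserving_eval (fun _ : Fin N => μ) j).map_eq] at h
  have hprod : meanField c μ = ∫⁻ z, Function.uncurry c z ∂(μ.prod μ) :=
    (lintegral_prod _ hc.aemeasurable).symm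
  rw [hprod, ← h, lintegral_map hc ((measurable_pi_apply i).prodMk (measurable_pi_apply j))]
  rfl

theorem otCost_le {c : X → X → ℝ≥0∞} (hc : Measurable (Function.uncurry c)) (N : ℕ)
    (μ : Measure X) [IsProbabilityMeasure μ] :
    otCost c N μ ≤ ((N * N - N : ℕ) : ℝ≥0∞) * meanField c μ := by
  refine (iInf₂_le _ (pi_mem_symPlans N μ)).trans (le_of_eq ?_)
  rw [lintegral_finsetSum]
  · rw [Finset.sum_congr rfl fun p hp => lintegral_pi_pair hc μ (Finset.mem_offDiag.1 hp).2.2]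
    simp [Finset.offDiag_card]
  · intro p _
    have h : Measurable fun x : Fin N → X => (x p.1, x p.2) :=
      (measurable_pi_apply p.1).prodMk (measurable_pi_apply p.2)
    exact hc.comp h

theorem gcCost_le_tsum (c : X → X → ℝ≥0∞) {N : ℝ} {μ : Measure X} [IsProbabilityMeasure μ]
    {α : ℕ → ℝ≥0∞} (h1 : ∑' n, α n = 1) (hN : ∑' n : ℕ, (n : ℝ≥0∞) * α n = ENNReal.ofReal N) :
    gcCost c N μ ≤ ∑' n, α n * otCost c n μ := by
  have hmem : (α, fun _ => μ) ∈ gcCompetitors N μ := by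
    refine ⟨fun _ => inferInstance, h1, ?_⟩
    ext s hs
    simp [Measure.sum_apply _ hs, ENNReal.tsum_mul_right, hN]
  exact (iInf₂_le _ hmem).trans (ENNReal.tsum_comp_le_tsum_of_injective
    (add_left_injective 2) fun n => α n * otCost c n μ)

/-- Put all the weight on the particle number `N`. -/
theorem gcCost_le_otCost (c : X → X → ℝ≥0∞) (N : ℕ) (μ : Measure X) [IsProbabilityMeasure μ] :
    gcCost c N μ ≤ otCost c N μ := by
  have key : ∀ f : ℕ → ℝ≥0∞, ∑' n, f n * (if n = N then 1 else 0) = f N := fun f => by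
    simp [mul_ite]
  refine (gcCost_le_tsum c (α := fun n => if n = N then 1 else 0) (by simp) ?_).trans ?_
  · simp
  · simp_rw [mul_comm _ (otCost _ _ _)]
    exact (key fun n => otCost c n μ).le

/-- Write `N = k + t` with `k` the integer part, and give `k` and `k + 1` the weights `1 - t` and
`t`. Product plans then have mean pair count `(1 - t)k(k - 1) + t(k + 1)k = N² - k - t²`. -/
theorem gcCost_le {c : X → X → ℝ≥0∞} (hc : Measurable (Function.uncurry c)) {N : ℝ} (hN : 0 ≤ N)
    (μ : Measure X) [IsProbabilityMeasure μ] :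
    gcCost c N μ ≤ ENNReal.ofReal N ^ 2 * meanField c μ := by
  set k := ⌊N⌋₊
  set t := N - k
  have ht : 0 ≤ t := sub_nonneg.2 (Nat.floor_le hN)
  have ht1 : t ≤ 1 := by have := Nat.lt_floor_add_one N; simp only [t]; linarith
  let α : ℕ → ℝ≥0∞ := fun n =>
    (if n = k then ENNReal.ofReal (1 - t) else 0) + (if n = k + 1 then ENNReal.ofReal t else 0)
  have key : ∀ f : ℕ → ℝ≥0∞,
      ∑' n, f n * α n = f k * ENNReal.ofReal (1 - t) + f (k + 1) * ENNReal.ofReal t := fun f => by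
    simp [α, mul_add, ENNReal.tsum_add, mul_ite]
  have h1 : ∑' n, α n = 1 := by
    have := key fun _ => 1
    simp only [one_mul] at this
    rw [this, ← ENNReal.ofReal_add (by linarith) ht]
    simp
  have hN' : ∑' n : ℕ, (n : ℝ≥0∞) * α n = ENNReal.ofReal N := by
    rw [key, ← ENNReal.ofReal_natCast, ← ENNReal.ofReal_natCast,
      ← ENNReal.ofReal_mul (by positivity), ← ENNReal.ofReal_mul (by positivity),
      ← ENNReal.ofReal_add (by have : 0 ≤ 1 - t := by linarith
                               positivity) (by positivity)]
    congr 1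
    push_cast
    simp only [t]
    ring
  calc gcCost c N μ ≤ ∑' n, α n * otCost c n μ := gcCost_le_tsum c h1 hN'
    _ ≤ ∑' n, ((n * n - n : ℕ) : ℝ≥0∞) * meanField c μ * α n :=
        ENNReal.tsum_le_tsum fun n => by
          rw [mul_comm]; gcongr; exact otCost_le hc n μ
    _ = (((k * k - k : ℕ) : ℝ≥0∞) * ENNReal.ofReal (1 - t) +
          (((k + 1) * (k + 1) - (k + 1) : ℕ) : ℝ≥0∞) * ENNReal.ofReal t) * meanField c μ := by
        rw [key]; ring
    _ ≤ ENNReal.ofReal N ^ 2 * meanField c μ := by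
        gcongr
        rw [← ENNReal.ofReal_natCast, ← ENNReal.ofReal_natCast,
          ← ENNReal.ofReal_mul (by positivity), ← ENNReal.ofReal_mul (by positivity),
          ← ENNReal.ofReal_add (by have : 0 ≤ 1 - t := by linarith
                                   positivity) (by positivity), ← ENNReal.ofReal_pow hN]
        apply ENNReal.ofReal_le_ofReal
        have hk : N = k + t := by simp [t]
        rw [hk, Nat.cast_sub (Nat.le_mul_self k), Nat.cast_sub (Nat.le_mul_self (k + 1))]
        push_cast
        have hk0 : (0 : ℝ) ≤ k := k.cast_nonneg
        nlinarith [sq_nonneg t]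

theorem two_mul_mul_le_add_sq (a b : ℝ≥0∞) : 2 * a * b ≤ a ^ 2 + b ^ 2 := by
  rcases eq_or_ne a ⊤ with rfl | ha
  · simp
  rcases eq_or_ne b ⊤ with rfl | hb
  · simp
  lift a to NNReal using ha
  lift b to NNReal using hb
  exact_mod_cast two_mul_le_add_sq a b

/-- The tangent line inequality for the expected number of pairs of particles in a region. -/
theorem two_mul_mul_le_lintegral_offDiag {n : ℕ} {ν : Measure X} {γ : Measure (Fin n → X)}
    (hγ : γ ∈ symPlans n ν) {χ : X → ℝ≥0∞} (hχ : Measurable χ) (hχ1 : ∀ x, χ x ≤ 1) (m : ℝ≥0∞) :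
    2 * m * (n * ∫⁻ x, χ x ∂ν) ≤
      (∫⁻ x, ∑ p ∈ (Finset.univ : Finset (Fin n)).offDiag, χ (x p.1) * χ (x p.2) ∂γ) +
        (n * ∫⁻ x, χ x ∂ν + m ^ 2) := by
  have := hγ.1
  have hm : ∀ i : Fin n, Measurable fun x : Fin n → X => χ (x i) := fun i =>
    hχ.comp (measurable_pi_apply i)
  have hsum : ∫⁻ x, ∑ i, χ (x i) ∂γ = n * ∫⁻ x, χ x ∂ν := by
    rw [lintegral_finsetSum _ fun i _ => hm i]
    have : ∀ i : Fin n, ∫⁻ x, χ (x i) ∂γ = ∫⁻ x, χ x ∂ν := fun i => by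
      rw [← hγ.2.2 i, lintegral_map hχ (measurable_pi_apply i)]
    simp [this]
  have hsm : Measurable fun x : Fin n → X => ∑ i, χ (x i) :=
    Finset.measurable_sum _ fun i _ => hm i
  have hpt : ∀ x : Fin n → X, 2 * m * ∑ i, χ (x i) ≤
      (∑ p ∈ (Finset.univ : Finset (Fin n)).offDiag, χ (x p.1) * χ (x p.2)) +
        (∑ i, χ (x i) + m ^ 2) := fun x => by
    refine (two_mul_mul_le_add_sq _ _).trans ?_
    rw [← add_assoc, add_comm (m ^ 2)]
    gcongr
    -- The square of the count splits into ordered pairs and a diagonal; the diagonal is at most the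
    -- count itself because `χ² ≤ χ`.
    rw [sq, Finset.sum_mul_sum, ← Finset.sum_product', ← Finset.diag_union_offDiag,
      Finset.sum_union (Finset.disjoint_diag_offDiag _), Finset.sum_diag, add_comm]
    gcongr with i
    exact mul_le_of_le_one_left' (hχ1 _)
  calc 2 * m * (n * ∫⁻ x, χ x ∂ν) = ∫⁻ x, 2 * m * ∑ i, χ (x i) ∂γ := by
        rw [lintegral_const_mul _ hsm, hsum]
    _ ≤ _ := lintegral_mono hpt
    _ = _ := by
        rw [lintegral_add_right _ (hsm.add_const _), lintegral_add_right _ measurable_const, hsum]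
        simp

variable {P : Type*} [MeasurableSpace P]

/-- Lower bound for the transport cost of a superposition of pair interactions `χ_p ⊗ χ_p`. -/
theorem lintegral_tsub_le_otCost {Λ : Measure P} [SFinite Λ] {χ : P → X → ℝ≥0∞}
    (hχ : Measurable (Function.uncurry χ)) (hχ1 : ∀ p x, χ p x ≤ 1) {c : X → X → ℝ≥0∞}
    (hc : ∀ x y, c x y = ∫⁻ p, χ p x * χ p y ∂Λ) (n : ℕ) (ν : Measure X) (m : P → ℝ≥0∞) :
    ∫⁻ p, (2 * m p * (n * ∫⁻ x, χ p x ∂ν) - (n * ∫⁻ x, χ p x ∂ν + m p ^ 2)) ∂Λ ≤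
      otCost c n ν := by
  refine le_iInf₂ fun γ hγ => ?_
  have := hγ.1
  have hpair : ∀ i j : Fin n,
      Measurable fun q : P × (Fin n → X) => χ q.1 (q.2 i) * χ q.1 (q.2 j) := fun i j =>
    (hχ.comp (measurable_fst.prodMk ((measurable_pi_apply i).comp measurable_snd))).mul
      (hχ.comp (measurable_fst.prodMk ((measurable_pi_apply j).comp measurable_snd)))
  calc _ ≤ ∫⁻ p, ∫⁻ x, ∑ q ∈ (Finset.univ : Finset (Fin n)).offDiag,
          χ p (x q.1) * χ p (x q.2) ∂γ ∂Λ :=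
        -- The truncated subtraction keeps the positive part separately for each `p`, which is what
        -- later yields `min(m, m²)` instead of `m`.
        lintegral_mono fun p => tsub_le_iff_right.2
          (two_mul_mul_le_lintegral_offDiag hγ (hχ.comp measurable_prodMk_left) (hχ1 p) _)
    _ = ∫⁻ x, ∫⁻ p, ∑ q ∈ (Finset.univ : Finset (Fin n)).offDiag,
          χ p (x q.1) * χ p (x q.2) ∂Λ ∂γ :=
        lintegral_lintegral_swap
          (Finset.measurable_sum _ fun q _ => hpair q.1 q.2).aemeasurable
    _ = _ := by
        refine lintegral_congr fun x => ?_
        rw [lintegral_finsetSum]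
        · simp_rw [hc]
        · exact fun q _ => (hpair q.1 q.2).comp measurable_prodMk_right

theorem otCost_zero (c : X → X → ℝ≥0∞) (μ : Measure X) [IsProbabilityMeasure μ] :
    otCost c 0 μ = 0 :=
  le_antisymm ((iInf₂_le _ (pi_mem_symPlans 0 μ)).trans (by simp)) bot_le

theorem otCost_one (c : X → X → ℝ≥0∞) (μ : Measure X) [IsProbabilityMeasure μ] :
    otCost c 1 μ = 0 := by
  refine le_antisymm ((iInf₂_le _ (pi_mem_symPlans 1 μ)).trans (le_of_eq ?_)) bot_le
  simp

theorem meanField_eq_lintegral_sq {Λ : Measure P} [SFinite Λ] {χ : P → X → ℝ≥0∞}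
    (hχ : Measurable (Function.uncurry χ)) {c : X → X → ℝ≥0∞}
    (hc : ∀ x y, c x y = ∫⁻ p, χ p x * χ p y ∂Λ) (μ : Measure X) [SFinite μ] :
    meanField c μ = ∫⁻ p, (∫⁻ x, χ p x ∂μ) ^ 2 ∂Λ := by
  have hp : ∀ p, Measurable (χ p) := fun p => hχ.comp measurable_prodMk_left
  have h1 : ∀ x, ∫⁻ y, c x y ∂μ = ∫⁻ p, χ p x * ∫⁻ y, χ p y ∂μ ∂Λ := fun x => by
    simp_rw [hc]
    rw [lintegral_lintegral_swap]
    · exact lintegral_congr fun p => lintegral_const_mul _ (hp p)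
    · exact ((hχ.comp (measurable_snd.prodMk measurable_const)).mul
        (hχ.comp measurable_swap)).aemeasurable
  have hI : Measurable fun p => ∫⁻ y, χ p y ∂μ := hχ.lintegral_prod_right'
  rw [meanField]
  simp_rw [h1]
  rw [lintegral_lintegral_swap]
  · refine lintegral_congr fun p => ?_
    rw [lintegral_mul_const _ (hp p), sq]
  · exact ((hχ.comp measurable_swap).mul (hI.comp measurable_snd)).aemeasurable

/-- The indirect energy of a superposition of the pair interactions `χ_p ⊗ χ_p` is controlled by
the truncated mean-field fluctuations. -/
theorem sq_mul_meanField_le_gcCost_add {Λ : Measure P} [SFinite Λ] {χ : P → X → ℝ≥0∞}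
    (hχ : Measurable (Function.uncurry χ)) (hχ1 : ∀ p x, χ p x ≤ 1) {c : X → X → ℝ≥0∞}
    (hc : ∀ x y, c x y = ∫⁻ p, χ p x * χ p y ∂Λ) (N : ℝ) (μ : Measure X)
    [IsProbabilityMeasure μ] :
    ENNReal.ofReal N ^ 2 * meanField c μ ≤ gcCost c N μ +
      ∫⁻ p, min (ENNReal.ofReal N * ∫⁻ x, χ p x ∂μ)
        ((ENNReal.ofReal N * ∫⁻ x, χ p x ∂μ) ^ 2) ∂Λ := by
  -- The overall mean is used as the tangency point for every particle number `n`, so the bounds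
  -- remain linear in the competitor and average exactly.
  set m : P → ℝ≥0∞ := fun p => ENNReal.ofReal N * ∫⁻ x, χ p x ∂μ with hmdef
  have hI : ∀ ν : Measure X, SFinite ν → Measurable fun p => ∫⁻ y, χ p y ∂ν := fun ν _ =>
    hχ.lintegral_prod_right'
  have hm : Measurable m := (hI μ inferInstance).const_mul _
  have hmtop : ∀ p, m p ≠ ⊤ := fun p => by
    refine ENNReal.mul_ne_top ENNReal.ofReal_ne_top (ne_top_of_le_ne_top ENNReal.one_ne_top ?_)
    calc ∫⁻ x, χ p x ∂μ ≤ ∫⁻ _, 1 ∂μ := lintegral_mono (hχ1 p)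
      _ = 1 := by simp
  have hMF : ENNReal.ofReal N ^ 2 * meanField c μ = ∫⁻ p, m p ^ 2 ∂Λ := by
    rw [meanField_eq_lintegral_sq hχ hc, ← lintegral_const_mul _ ((hI μ inferInstance).pow_const 2)]
    simp_rw [hmdef, mul_pow]
  have hlow : ∫⁻ p, (2 * m p * m p - (m p + m p ^ 2)) ∂Λ ≤ gcCost c N μ := by
    refine le_iInf₂ fun q hq => ?_
    obtain ⟨α, ν⟩ := q
    obtain ⟨hprob, hα, hν⟩ := hq
    simp only at hprob hα hν
    have hmean : ∀ p, ∑' n : ℕ, α n * (n * ∫⁻ x, χ p x ∂(ν n)) = m p := fun p => by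
      rw [hmdef]
      simp only
      rw [← smul_eq_mul, ← lintegral_smul_measure, ← hν, lintegral_sum_measure]
      refine tsum_congr fun n => ?_
      rw [lintegral_smul_measure]
      simp only [smul_eq_mul]
      ring
    have hall : ∑' n, α n * otCost c n (ν n) =
        ∑' n, α (n + 2) * otCost c (n + 2) (ν (n + 2)) := by
      have h := ENNReal.summable.sum_add_tsum_nat_add' (f := fun n => α n * otCost c n (ν n))
        (k := 2)
      rw [← h]
      have h0 := hprob 0
      have h1 := hprob 1
      simp [Finset.sum_range_succ, otCost_zero, otCost_one]
    change _ ≤ ∑' n, α (n + 2) * otCost c (n + 2) (ν (n + 2))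
    rw [← hall]
    calc ∫⁻ p, (2 * m p * m p - (m p + m p ^ 2)) ∂Λ
        ≤ ∫⁻ p, ∑' n : ℕ, α n * (2 * m p * (n * ∫⁻ x, χ p x ∂(ν n)) -
            (n * ∫⁻ x, χ p x ∂(ν n) + m p ^ 2)) ∂Λ := by
          refine lintegral_mono fun p => tsub_le_iff_right.2 ?_
          calc 2 * m p * m p = ∑' n : ℕ, α n * (2 * m p * (n * ∫⁻ x, χ p x ∂(ν n))) := by
                rw [← ENNReal.tsum_mul_left.trans (congrArg _ (hmean p))]
                exact tsum_congr fun n => by ring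
            _ ≤ ∑' n : ℕ, (α n * (2 * m p * (n * ∫⁻ x, χ p x ∂(ν n)) -
                  (n * ∫⁻ x, χ p x ∂(ν n) + m p ^ 2)) +
                  (α n * (n * ∫⁻ x, χ p x ∂(ν n)) + α n * m p ^ 2)) := by
                refine ENNReal.tsum_le_tsum fun n => ?_
                rw [← mul_add, ← mul_add]
                gcongr
                exact le_tsub_add
            _ = _ := by
                rw [ENNReal.tsum_add, ENNReal.tsum_add, hmean, ENNReal.tsum_mul_right, hα,
                  one_mul]
      _ = ∑' n : ℕ, α n * ∫⁻ p, (2 * m p * (n * ∫⁻ x, χ p x ∂(ν n)) -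
            (n * ∫⁻ x, χ p x ∂(ν n) + m p ^ 2)) ∂Λ := by
          have hmeas : ∀ n : ℕ, Measurable fun p => 2 * m p * (n * ∫⁻ x, χ p x ∂(ν n)) -
              (n * ∫⁻ x, χ p x ∂(ν n) + m p ^ 2) := fun n => by
            have := hprob n
            have := hI (ν n) inferInstance
            fun_prop
          rw [lintegral_tsum fun n => ((hmeas n).const_mul _).aemeasurable]
          exact tsum_congr fun n => lintegral_const_mul _ (hmeas n)
      _ ≤ _ := ENNReal.tsum_le_tsum fun n => by
          gcongr
          exact lintegral_tsub_le_otCost hχ hχ1 hc n (ν n) m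
  rw [hMF]
  refine le_trans ?_ (add_le_add_left hlow _)
  rw [← lintegral_add_right _ (hm.min (hm.pow_const 2))]
  refine lintegral_mono fun p => ?_
  -- What remains is `m² ≤ (m² - m)₊ + min(m, m²)`.
  have h2 : 2 * m p * m p - (m p + m p ^ 2) = m p ^ 2 - m p := by
    rw [show 2 * m p * m p = m p ^ 2 + m p ^ 2 by ring,
      ENNReal.add_sub_add_eq_sub_right (ENNReal.pow_ne_top (hmtop p))]
  rw [h2]
  rcases le_total (m p) (m p ^ 2) with h | h
  · rw [min_eq_left h]
    exact le_tsub_add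
  · rw [min_eq_right h]
    exact le_add_self

end Abstract

/-! ### Integrals of powers on the half-line. -/

section PowerIntegrals

theorem lintegral_Ioi_rpow {a s : ℝ} (ha : 0 < a) (hs : 0 < s) :
    ∫⁻ r in Set.Ioi a, ENNReal.ofReal (r ^ (-s - 1)) = ENNReal.ofReal (a ^ (-s) / s) := by
  rw [← ofReal_integral_eq_lintegral_ofReal (integrableOn_Ioi_rpow_of_lt (by linarith) ha)
    ((ae_restrict_iff' measurableSet_Ioi).2 (.of_forall fun r hr =>
      Real.rpow_nonneg (ha.trans hr).le _)), integral_Ioi_rpow_of_lt (by linarith) ha]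
  congr 1
  rw [sub_add_cancel, neg_div_neg_eq]

theorem lintegral_Ioc_rpow {a q : ℝ} (ha : 0 ≤ a) (hq : 0 < q) :
    ∫⁻ r in Set.Ioc 0 a, ENNReal.ofReal (r ^ (q - 1)) = ENNReal.ofReal (a ^ q / q) := by
  have hint : IntervalIntegrable (fun r : ℝ => r ^ (q - 1)) volume 0 a :=
    intervalIntegral.intervalIntegrable_rpow' (by linarith)
  rw [← ofReal_integral_eq_lintegral_ofReal
    ((intervalIntegrable_iff_integrableOn_Ioc_of_le ha).1 hint)
    ((ae_restrict_iff' measurableSet_Ioc).2 (.of_forall fun r hr =>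
      Real.rpow_nonneg hr.1.le _)), ← intervalIntegral.integral_of_le ha,
    integral_rpow (Or.inl (by linarith))]
  simp [hq.ne']

theorem lintegral_Ioi_zero_rpow (a : ℝ) :
    ∫⁻ r in Set.Ioi (0 : ℝ), ENNReal.ofReal (r ^ a) = ⊤ := by
  by_contra h
  refine not_integrableOn_Ioi_rpow a ⟨by fun_prop, ?_⟩
  rw [hasFiniteIntegral_iff_ofReal ((ae_restrict_iff' measurableSet_Ioi).2 (.of_forall
    fun r hr => Real.rpow_nonneg (le_of_lt hr) _))]
  exact lt_top_iff_ne_top.2 h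

theorem lintegral_Ioi_zero_comp_mul_left {t : ℝ} (ht : 0 < t) {g : ℝ → ℝ≥0∞}
    (hg : Measurable g) :
    ∫⁻ r in Set.Ioi 0, g r = ENNReal.ofReal t * ∫⁻ r in Set.Ioi 0, g (t * r) := by
  have h1 : ∀ r, (Set.Ioi (0 : ℝ)).indicator (fun r => g (t * r)) r =
      (Set.Ioi (0 : ℝ)).indicator g (t * r) := fun r => by
    by_cases hr : 0 < r
    · simp [Set.indicator, hr, ht]
    · simp [Set.indicator, hr, ht]
  rw [← lintegral_indicator measurableSet_Ioi, ← lintegral_indicator measurableSet_Ioi]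
  simp_rw [h1]
  have hmap := Real.smul_map_volume_mul_left ht.ne'
  rw [abs_of_pos ht] at hmap
  conv_lhs => rw [← hmap]
  rw [lintegral_smul_measure, lintegral_map (hg.indicator measurableSet_Ioi) (by fun_prop)]
  rfl

end PowerIntegrals

/-! ### Indicators of balls as a jointly measurable family. -/

section BallInd

variable {E : Type*} [PseudoMetricSpace E]

/-- The indicator function of the ball with radius `p.1` and centre `p.2`. -/
noncomputable def ballInd (p : ℝ × E) : E → ℝ≥0∞ := (Metric.ball p.2 p.1).indicator 1

theorem ballInd_le_one (p : ℝ × E) (x : E) : ballInd p x ≤ 1 :=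
  Set.indicator_le_self' (fun _ _ => zero_le) x

variable [MeasurableSpace E]

theorem measurable_ballInd [SecondCountableTopology E] [OpensMeasurableSpace E] : Measurable (Function.uncurry (ballInd (E := E))) := by
  have hs : MeasurableSet {q : (ℝ × E) × E | dist q.2 q.1.2 < q.1.1} :=
    measurableSet_lt (by fun_prop) (by fun_prop)
  exact measurable_one.indicator hs

theorem lintegral_ballInd [OpensMeasurableSpace E] (p : ℝ × E) (μ : Measure E) :
    ∫⁻ x, ballInd p x ∂μ = μ (Metric.ball p.2 p.1) :=
  lintegral_indicator_one measurableSet_ball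

end BallInd

/-! ### The Riesz kernel as a superposition of balls. -/

section BallKernel

open scoped Pointwise

variable {E : Type*} [NormedAddCommGroup E] [InnerProductSpace ℝ E] [FiniteDimensional ℝ E]
  [MeasurableSpace E] [BorelSpace E]

/-- The weight `r ^ (-(d + s + 1)) dr` on radii, times Lebesgue measure on centres. -/
noncomputable def scaleMeasure (E : Type*) [NormedAddCommGroup E] [InnerProductSpace ℝ E]
    [FiniteDimensional ℝ E] [MeasurableSpace E] [BorelSpace E] (s : ℝ) : Measure (ℝ × E) :=
  ((volume.restrict (Set.Ioi 0)).withDensity fun r : ℝ =>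
    ENNReal.ofReal (r ^ (-(Module.finrank ℝ E : ℝ) - s - 1))).prod volume

instance scaleMeasure.instSFinite (s : ℝ) : SFinite (scaleMeasure E s) := by
  unfold scaleMeasure; infer_instance

theorem lintegral_scaleMeasure (s : ℝ) {g : ℝ × E → ℝ≥0∞} (hg : Measurable g) :
    ∫⁻ p, g p ∂(scaleMeasure E s) = ∫⁻ r in Set.Ioi (0 : ℝ),
      ENNReal.ofReal (r ^ (-(Module.finrank ℝ E : ℝ) - s - 1)) * ∫⁻ z, g (r, z) := by
  rw [scaleMeasure, lintegral_prod _ hg.aemeasurable,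
    lintegral_withDensity_eq_lintegral_mul _ (by fun_prop) hg.lintegral_prod_right']
  rfl

/-- The superposition of the ball interactions over all balls. -/
noncomputable def ballKernel (s : ℝ) (x y : E) : ℝ≥0∞ :=
  ∫⁻ p, ballInd p x * ballInd p y ∂(scaleMeasure E s)

/-- A ball of radius `r` contains both points exactly when its centre lies within `r` of each, so
integrating over centres leaves the volume of a lens. -/
theorem ballKernel_eq (s : ℝ) (x y : E) :
    ballKernel s x y = ∫⁻ r in Set.Ioi (0 : ℝ),
      ENNReal.ofReal (r ^ (-(Module.finrank ℝ E : ℝ) - s - 1)) *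
        volume (Metric.ball x r ∩ Metric.ball y r) := by
  have hm : ∀ x : E, Measurable fun p : ℝ × E => ballInd p x := fun x =>
    measurable_ballInd.comp measurable_prodMk_right
  have hxy : Measurable fun p : ℝ × E => ballInd p x * ballInd p y := (hm x).mul (hm y)
  rw [ballKernel, lintegral_scaleMeasure s hxy]
  refine lintegral_congr fun r => ?_
  congr 1
  rw [← lintegral_indicator_one (measurableSet_ball.inter measurableSet_ball)]
  refine lintegral_congr fun z => ?_
  rw [Set.inter_indicator_one, Pi.mul_apply]
  simp only [ballInd, Set.indicator, Metric.mem_ball, dist_comm z, Pi.one_apply]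

theorem ballKernel_eq_zero_sub (s : ℝ) (x y : E) :
    ballKernel s x y = ballKernel s 0 (y - x) := by
  simp only [ballKernel_eq]
  refine lintegral_congr fun r => ?_
  congr 1
  rw [← measure_preimage_add volume x]
  congr 1
  ext z
  simp [dist_eq_norm, add_sub_assoc, sub_sub_eq_add_sub, add_comm]

/-- The reflection in the hyperplane orthogonal to `v - w` fixes the origin, sends `v` to `w` and
preserves volume. -/
theorem ballKernel_zero_eq_of_norm_eq (s : ℝ) {v w : E} (h : ‖v‖ = ‖w‖) :
    ballKernel s 0 v = ballKernel s 0 w := by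
  simp only [ballKernel_eq]
  refine lintegral_congr fun r => ?_
  congr 1
  let φ : E ≃ₗᵢ[ℝ] E := (Submodule.span ℝ {v - w})ᗮ.reflection
  have hφ : φ v = w := Submodule.reflection_sub h
  rw [← φ.measurePreserving.measure_preimage (s := Metric.ball 0 r ∩ Metric.ball w r)
    (measurableSet_ball.inter measurableSet_ball).nullMeasurableSet]
  congr 1
  ext z
  simp [← hφ]

theorem measurable_measure_ball_inter_ball (x y : ℝ → E) (hx : Measurable x) (hy : Measurable y) :
    Measurable fun r : ℝ => volume (Metric.ball (x r) r ∩ Metric.ball (y r) r) := by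
  have hs : MeasurableSet ({q : ℝ × E | dist q.2 (x q.1) < q.1} ∩
      {q : ℝ × E | dist q.2 (y q.1) < q.1}) :=
    (measurableSet_lt (by fun_prop) (by fun_prop)).inter
      (measurableSet_lt (by fun_prop) (by fun_prop))
  exact measurable_measure_prodMk_left hs

/-- Under `r ↦ t r` the weight gives `t^(-d-s-1)`, the lens volume `t^d` and the differential `t`.
-/
theorem ballKernel_zero_smul (s : ℝ) {t : ℝ} (ht : 0 < t) (v : E) :
    ballKernel s 0 (t • v) = ENNReal.ofReal (t ^ (-s)) * ballKernel s 0 v := by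
  simp only [ballKernel_eq]
  have hmeas : ∀ v : E, Measurable fun r : ℝ =>
      ENNReal.ofReal (r ^ (-(Module.finrank ℝ E : ℝ) - s - 1)) *
        volume (Metric.ball (0 : E) r ∩ Metric.ball v r) := fun v =>
    Measurable.mul (by fun_prop)
      (measurable_measure_ball_inter_ball _ _ measurable_const measurable_const)
  rw [lintegral_Ioi_zero_comp_mul_left ht (hmeas _), ← lintegral_const_mul _ (by
    exact (hmeas (t • v)).comp (measurable_const_mul t)), ← lintegral_const_mul _ (hmeas v)]
  refine setLIntegral_congr_fun measurableSet_Ioi fun r hr => ?_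
  have hr : 0 < r := hr
  have hball : Metric.ball (0 : E) (t * r) ∩ Metric.ball (t • v) (t * r) =
      t • (Metric.ball (0 : E) r ∩ Metric.ball v r) := by
    rw [Set.smul_set_inter₀ ht.ne', smul_ball ht.ne', smul_ball ht.ne', smul_zero,
      Real.norm_of_nonneg ht.le]
  rw [hball, Measure.addHaar_smul, abs_of_pos (pow_pos ht _), ← mul_assoc, ← mul_assoc,
    ← mul_assoc, ← ENNReal.ofReal_mul ht.le, ← ENNReal.ofReal_mul (by positivity),
    ← ENNReal.ofReal_mul (by positivity)]
  congr 2
  rw [Real.mul_rpow ht.le hr.le, ← Real.rpow_natCast]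
  nth_rewrite 1 [← Real.rpow_one t]
  rw [← mul_assoc, ← Real.rpow_add ht, mul_right_comm, ← Real.rpow_add ht]
  congr 2
  ring

theorem ballKernel_self [Nontrivial E] (s : ℝ) (x : E) : ballKernel s x x = ⊤ := by
  rw [ballKernel_eq]
  have : ∀ r ∈ Set.Ioi (0 : ℝ), ENNReal.ofReal (r ^ (-(Module.finrank ℝ E : ℝ) - s - 1)) *
      volume (Metric.ball x r ∩ Metric.ball x r) =
      ENNReal.ofReal (r ^ (-s - 1)) * volume (Metric.ball (0 : E) 1) := fun r hr => by
    have hr : 0 < r := hr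
    rw [Set.inter_self, Measure.addHaar_ball _ _ hr.le, ← mul_assoc,
      ← ENNReal.ofReal_mul (by positivity), ← Real.rpow_natCast, ← Real.rpow_add hr]
    congr 3
    ring
  rw [setLIntegral_congr_fun measurableSet_Ioi this, lintegral_mul_const _ (by fun_prop),
    lintegral_Ioi_zero_rpow, ENNReal.top_mul]
  exact (Metric.measure_ball_pos volume _ one_pos).ne'

/-- For `r > 1` the lens contains the ball of radius `r/2` about the midpoint `e/2`. The explicit
dependence on `s` is needed for a constant uniform in `s`. -/
theorem le_ballKernel_of_norm_eq_one [Nontrivial E] {s : ℝ} (hs : 0 < s) {e : E} (he : ‖e‖ = 1) :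
    ENNReal.ofReal ((1 / 2) ^ Module.finrank ℝ E / s) * volume (Metric.ball (0 : E) 1) ≤
      ballKernel s 0 e := by
  rw [ballKernel_eq]
  calc _ = ∫⁻ r in Set.Ioi (1 : ℝ), ENNReal.ofReal ((1 / 2) ^ Module.finrank ℝ E) *
        volume (Metric.ball (0 : E) 1) * ENNReal.ofReal (r ^ (-s - 1)) := by
        rw [lintegral_const_mul _ (by fun_prop), lintegral_Ioi_rpow one_pos hs, Real.one_rpow,
          mul_right_comm, ← ENNReal.ofReal_mul (by positivity)]
        congr 2
        ring
    _ ≤ ∫⁻ r in Set.Ioi (1 : ℝ), ENNReal.ofReal (r ^ (-(Module.finrank ℝ E : ℝ) - s - 1)) *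
        volume (Metric.ball 0 r ∩ Metric.ball e r) := by
        refine setLIntegral_mono' measurableSet_Ioi fun r hr => ?_
        have hr : 1 < r := hr
        have hr0 : 0 < r := by linarith
        have hsub : Metric.ball ((1 / 2 : ℝ) • e) (r / 2) ⊆ Metric.ball 0 r ∩ Metric.ball e r := by
          have hn : ‖(1 / 2 : ℝ) • e‖ = 1 / 2 := by rw [norm_smul, he]; norm_num
          refine Set.subset_inter (Metric.ball_subset_ball' ?_) (Metric.ball_subset_ball' ?_)
          · rw [dist_zero_right, hn]; linarith
          · have : (1 / 2 : ℝ) • e - e = -((1 / 2 : ℝ) • e) := by module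
            rw [dist_eq_norm, this, norm_neg, hn]; linarith
        refine le_trans (le_of_eq ?_) (mul_le_mul_right (measure_mono hsub) _)
        rw [Measure.addHaar_ball volume ((1 / 2 : ℝ) • e) (show 0 ≤ r / 2 by positivity),
          ← mul_assoc, mul_right_comm,
          ← ENNReal.ofReal_mul (by positivity), ← ENNReal.ofReal_mul (by positivity)]
        congr 2
        rw [div_eq_mul_one_div r 2, mul_pow r, ← mul_assoc, ← Real.rpow_natCast r,
          ← Real.rpow_add hr0, mul_comm]
        congr 2
        ring
    _ ≤ _ := lintegral_mono_set (Set.Ioi_subset_Ioi zero_le_one)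

/-- The lens is empty for `r ≤ 1/2`; beyond that the integrand is at most a multiple of `r^(-s-1)`.
-/
theorem ballKernel_lt_top_of_norm_eq_one [Nontrivial E] {s : ℝ} (hs : 0 < s) {e : E}
    (he : ‖e‖ = 1) : ballKernel s 0 e < ⊤ := by
  rw [ballKernel_eq]
  calc _ ≤ ∫⁻ r in Set.Ioi (0 : ℝ), (Set.Ioi (1 / 2 : ℝ)).indicator (fun r =>
        ENNReal.ofReal (r ^ (-s - 1)) * volume (Metric.ball (0 : E) 1)) r := by
        refine setLIntegral_mono' measurableSet_Ioi fun r hr => ?_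
        have hr : 0 < r := hr
        by_cases h : 1 / 2 < r
        · rw [Set.indicator_of_mem (show r ∈ Set.Ioi (1 / 2 : ℝ) from h)]
          refine (mul_le_mul_right (measure_mono Set.inter_subset_left) _).trans (le_of_eq ?_)
          rw [Measure.addHaar_ball _ _ hr.le, ← mul_assoc, ← ENNReal.ofReal_mul (by positivity),
            ← Real.rpow_natCast, ← Real.rpow_add hr]
          congr 3
          ring
        · have : Metric.ball (0 : E) r ∩ Metric.ball e r = ∅ :=
            (Metric.ball_disjoint_ball (by rw [dist_zero_left, he]; linarith)).inter_eq
          simp [this]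
    _ ≤ ∫⁻ r, (Set.Ioi (1 / 2 : ℝ)).indicator (fun r =>
        ENNReal.ofReal (r ^ (-s - 1)) * volume (Metric.ball (0 : E) 1)) r :=
        setLIntegral_le_lintegral _ _
    _ < ⊤ := by
        rw [lintegral_indicator measurableSet_Ioi, lintegral_mul_const _ (by fun_prop),
          lintegral_Ioi_rpow (by norm_num) hs]
        exact ENNReal.mul_lt_top ENNReal.ofReal_lt_top measure_ball_lt_top

/-- The Fefferman–de la Llave representation of the Riesz kernel. -/
theorem ballKernel_eq_mul_edist_rpow [Nontrivial E] {s : ℝ} (hs : 0 < s) {e : E} (he : ‖e‖ = 1)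
    (x y : E) : ballKernel s x y = ballKernel s 0 e * edist x y ^ (-s) := by
  rcases eq_or_ne x y with rfl | hxy
  · have hpos : ballKernel s 0 e ≠ 0 := by
      refine (lt_of_lt_of_le ?_ (le_ballKernel_of_norm_eq_one hs he)).ne'
      exact ENNReal.mul_pos (ENNReal.ofReal_pos.2 (by positivity)).ne'
        (Metric.measure_ball_pos volume _ one_pos).ne'
    rw [ballKernel_self, edist_self, ENNReal.zero_rpow_of_neg (by linarith), ENNReal.mul_top hpos]
  · have ht : 0 < ‖y - x‖ := norm_pos_iff.2 (sub_ne_zero.2 hxy.symm)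
    have hn : ‖y - x‖ = ‖‖y - x‖ • e‖ := by rw [norm_smul, he, norm_norm, mul_one]
    rw [ballKernel_eq_zero_sub, ballKernel_zero_eq_of_norm_eq s hn, ballKernel_zero_smul s ht,
      mul_comm, edist_comm, edist_dist, dist_eq_norm, ENNReal.ofReal_rpow_of_pos ht]

end BallKernel

/-- Lets the high part `a` of a ball's mass enter linearly and the low part `b` quadratically. The
linear branch serves for `b ≥ 1/2` or `b ≤ a`, the quadratic one for `a < b < 1/2`. -/
theorem min_add_sq_le (a b : ℝ≥0∞) : min (a + b) ((a + b) ^ 2) ≤ 2 * (a + b ^ 2) := by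
  rcases eq_or_ne a ⊤ with rfl | ha
  · simp
  rcases eq_or_ne b ⊤ with rfl | hb
  · simp
  lift a to NNReal using ha
  lift b to NNReal using hb
  have key : min (a + b) ((a + b) ^ 2) ≤ 2 * (a + b ^ 2) := by
    rw [min_le_iff, ← NNReal.coe_le_coe, ← NNReal.coe_le_coe]
    push_cast
    have h1 : (0 : ℝ) ≤ a := a.2
    have h2 : (0 : ℝ) ≤ b := b.2
    by_cases hb : (1 : ℝ) / 2 ≤ b
    · left; nlinarith
    by_cases ha : (b : ℝ) ≤ a
    · left; nlinarith
    · right; nlinarith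
  exact_mod_cast key

theorem setLIntegral_sq_le {X : Type*} [MeasurableSpace X] (μ : Measure X) (B : Set X)
    {g : X → ℝ≥0∞} (hg : Measurable g) :
    (∫⁻ x in B, g x ∂μ) ^ 2 ≤ μ B * ∫⁻ x in B, g x ^ 2 ∂μ := by
  have h := ENNReal.lintegral_mul_le_Lp_mul_Lq (μ.restrict B) Real.HolderConjugate.two_two
    (f := 1) (g := g) aemeasurable_one hg.aemeasurable
  have hhalf : ∀ a : ℝ≥0∞, (a ^ (1 / 2 : ℝ)) ^ 2 = a := fun a => by
    rw [← ENNReal.rpow_two, ← ENNReal.rpow_mul]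
    norm_num
  simp only [one_mul, Pi.mul_apply, Pi.one_apply, ENNReal.rpow_two] at h
  calc (∫⁻ x in B, g x ∂μ) ^ 2 ≤ _ := pow_le_pow_left' h 2
    _ = _ := by
      rw [mul_pow, hhalf, hhalf]
      simp

/-! ### Radial integrals for the density cut at height `r^(-d)`. -/

section Threshold

variable {d : ℕ}

theorem rpow_neg_lt_iff (hd : 0 < d) {r t : ℝ} (hr : 0 < r) (ht : 0 < t) :
    r ^ (-(d : ℝ)) < t ↔ t ^ (-(1 / (d : ℝ))) < r := by
  have hd' : (0 : ℝ) < d := by exact_mod_cast hd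
  have h1 : t = (t ^ (-(1 / (d : ℝ)))) ^ (-(d : ℝ)) := by
    rw [← Real.rpow_mul ht.le]
    field_simp
    simp
  conv_lhs => rw [h1]
  exact Real.rpow_lt_rpow_iff_of_neg hr (by positivity) (by linarith)

/-- For `t > 0` the cut selects `r > t^(-1/d)`, where `r^(-s-1)` integrates to `t^(s/d) / s`. -/
theorem lintegral_threshold_high (hd : 0 < d) {s t : ℝ} (hs : 0 < s) (ht : 0 ≤ t) :
    ∫⁻ r in Set.Ioi (0 : ℝ), ENNReal.ofReal (r ^ (-s - 1)) *
        (if r ^ (-(d : ℝ)) < t then ENNReal.ofReal t else 0) ≤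
      ENNReal.ofReal (1 / s) * ENNReal.ofReal (t ^ (1 + s / d)) := by
  have hd' : (0 : ℝ) < d := by exact_mod_cast hd
  rcases ht.eq_or_lt with rfl | ht
  · simp
  set a := t ^ (-(1 / (d : ℝ)))
  have ha : 0 < a := by positivity
  calc _ ≤ ∫⁻ r in Set.Ioi (0 : ℝ), (Set.Ioi a).indicator (fun r =>
        ENNReal.ofReal (r ^ (-s - 1)) * ENNReal.ofReal t) r := by
        refine setLIntegral_mono' measurableSet_Ioi fun r hr => ?_
        by_cases h : a < r
        · rw [if_pos ((rpow_neg_lt_iff hd hr ht).2 h),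
            Set.indicator_of_mem (show r ∈ Set.Ioi a from h)]
        · rw [if_neg fun h' => h ((rpow_neg_lt_iff hd hr ht).1 h'), mul_zero]
          exact zero_le
    _ ≤ ∫⁻ r in Set.Ioi a, ENNReal.ofReal (r ^ (-s - 1)) * ENNReal.ofReal t := by
        rw [← lintegral_indicator measurableSet_Ioi (μ := volume) fun _ => _ * _]
        exact setLIntegral_le_lintegral _ _
    _ = _ := by
        rw [lintegral_mul_const _ (by fun_prop), lintegral_Ioi_rpow ha hs,
          ← ENNReal.ofReal_mul (by positivity), ← ENNReal.ofReal_mul (by positivity)]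
        congr 1
        rw [← Real.rpow_mul ht.le, Real.rpow_add ht, Real.rpow_one]
        have : -(1 / (d : ℝ)) * -s = s / d := by ring
        rw [this]
        ring

/-- For `t > 0` only `r ≤ t^(-1/d)` contributes, and `t² · t^(-(d-s)/d) = t^(1 + s/d)`; convergence
at `r = 0` needs `s < d`. -/
theorem lintegral_threshold_low (hd : 0 < d) {s t : ℝ} (hs : s < d) (ht : 0 ≤ t) :
    ∫⁻ r in Set.Ioi (0 : ℝ), ENNReal.ofReal (r ^ ((d : ℝ) - s - 1)) *
        (if r ^ (-(d : ℝ)) < t then 0 else ENNReal.ofReal t) ^ 2 ≤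
      ENNReal.ofReal (1 / (d - s)) * ENNReal.ofReal (t ^ (1 + s / d)) := by
  have hd' : (0 : ℝ) < d := by exact_mod_cast hd
  rcases ht.eq_or_lt with rfl | ht
  · simp
  set a := t ^ (-(1 / (d : ℝ)))
  have ha : 0 < a := by positivity
  have hq : 0 < (d : ℝ) - s := by linarith
  calc _ ≤ ∫⁻ r in Set.Ioi (0 : ℝ), (Set.Ioc 0 a).indicator (fun r =>
        ENNReal.ofReal (r ^ ((d : ℝ) - s - 1)) * ENNReal.ofReal t ^ 2) r := by
        refine setLIntegral_mono' measurableSet_Ioi fun r hr => ?_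
        by_cases h : a < r
        · rw [if_pos ((rpow_neg_lt_iff hd hr ht).2 h), zero_pow two_ne_zero, mul_zero]
          exact zero_le
        · rw [if_neg fun h' => h ((rpow_neg_lt_iff hd hr ht).1 h'),
            Set.indicator_of_mem (show r ∈ Set.Ioc 0 a from ⟨hr, not_lt.1 h⟩)]
    _ ≤ ∫⁻ r in Set.Ioc 0 a, ENNReal.ofReal (r ^ ((d : ℝ) - s - 1)) * ENNReal.ofReal t ^ 2 := by
        rw [← lintegral_indicator measurableSet_Ioc (μ := volume) fun _ => _ * _]
        exact setLIntegral_le_lintegral _ _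
    _ = _ := by
        rw [lintegral_mul_const _ (by fun_prop), lintegral_Ioc_rpow ha.le hq,
          ← ENNReal.ofReal_pow ht.le, ← ENNReal.ofReal_mul (by positivity),
          ← ENNReal.ofReal_mul (by positivity)]
        congr 1
        have h2 : t ^ (1 + s / d) = a ^ ((d : ℝ) - s) * t ^ 2 := by
          rw [← Real.rpow_mul ht.le, ← Real.rpow_two, ← Real.rpow_add ht]
          congr 1
          field_simp
          ring
        rw [h2]
        ring

end Threshold

/-! ### Integrating the truncated fluctuations over all balls. -/

section Fluctuation

variable {E : Type*} [NormedAddCommGroup E] [InnerProductSpace ℝ E] [FiniteDimensional ℝ E]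
  [MeasurableSpace E] [BorelSpace E]

theorem lintegral_setLIntegral_ball [Nontrivial E] {r : ℝ} (hr : 0 ≤ r) {g : E → ℝ≥0∞}
    (hg : Measurable g) :
    ∫⁻ z, ∫⁻ x in Metric.ball z r, g x =
      ENNReal.ofReal (r ^ Module.finrank ℝ E) * volume (Metric.ball (0 : E) 1) * ∫⁻ x, g x := by
  have hs : MeasurableSet {q : E × E | dist q.2 q.1 < r} :=
    measurableSet_lt (by fun_prop) (by fun_prop)
  have h1 : ∀ z, ∫⁻ x in Metric.ball z r, g x =
      ∫⁻ x, {q : E × E | dist q.2 q.1 < r}.indicator (fun q => g q.2) (z, x) := fun z => by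
    rw [← lintegral_indicator measurableSet_ball]
    rfl
  simp_rw [h1]
  have hm : Measurable ({q : E × E | dist q.2 q.1 < r}.indicator fun q => g q.2) :=
    (hg.comp measurable_snd).indicator hs
  rw [lintegral_lintegral_swap (f := fun z x => {q : E × E | dist q.2 q.1 < r}.indicator
    (fun q => g q.2) (z, x)) hm.aemeasurable, ← lintegral_const_mul _ hg]
  refine lintegral_congr fun x => ?_
  have h2 : ∀ z, {q : E × E | dist q.2 q.1 < r}.indicator (fun q => g q.2) (z, x) =
      (Metric.ball x r).indicator (fun _ => g x) z := fun z => by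
    simp only [Set.indicator, Set.mem_ofPred_eq, Metric.mem_ball, dist_comm]
  simp_rw [h2]
  rw [lintegral_indicator_const measurableSet_ball, Measure.addHaar_ball _ _ hr, mul_comm]

/-- The quadratic term carries the ball volume twice: once from Cauchy–Schwarz inside each ball,
once from integrating over centres. -/
theorem lintegral_min_setLIntegral_ball_le [Nontrivial E] {r : ℝ} (hr : 0 ≤ r)
    {f F G : E → ℝ≥0∞} (hF : Measurable F) (hG : Measurable G) (hf : ∀ x, f x = F x + G x) :
    ∫⁻ z, min (∫⁻ x in Metric.ball z r, f x) ((∫⁻ x in Metric.ball z r, f x) ^ 2) ≤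
      2 * (ENNReal.ofReal (r ^ Module.finrank ℝ E) * volume (Metric.ball (0 : E) 1) *
          ∫⁻ x, F x) +
        2 * ((ENNReal.ofReal (r ^ Module.finrank ℝ E) * volume (Metric.ball (0 : E) 1)) ^ 2 *
          ∫⁻ x, G x ^ 2) := by
  set V := ENNReal.ofReal (r ^ Module.finrank ℝ E) * volume (Metric.ball (0 : E) 1) with hV
  have hVtop : V ≠ ⊤ := ENNReal.mul_ne_top ENNReal.ofReal_ne_top measure_ball_lt_top.ne
  have hball : ∀ z : E, volume (Metric.ball z r) = V := fun z => Measure.addHaar_ball _ z hr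
  have hmeas : ∀ g : E → ℝ≥0∞, Measurable g →
      Measurable fun z => ∫⁻ x in Metric.ball z r, g x := fun g hg => by
    have hs : MeasurableSet {q : E × E | dist q.2 q.1 < r} :=
      measurableSet_lt (by fun_prop) (by fun_prop)
    have h := ((hg.comp measurable_snd).indicator hs).lintegral_prod_right' (ν := volume)
    convert h using 2 with z
    rw [← lintegral_indicator measurableSet_ball]
    rfl
  calc _ ≤ ∫⁻ z, (2 * (∫⁻ x in Metric.ball z r, F x) +
          2 * (V * ∫⁻ x in Metric.ball z r, G x ^ 2)) := by
        refine lintegral_mono fun z => ?_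
        simp_rw [hf]
        rw [lintegral_add_left hF, ← mul_add]
        refine (min_add_sq_le _ _).trans ?_
        gcongr
        rw [← hball z]
        exact setLIntegral_sq_le _ _ hG
    _ = _ := by
        rw [lintegral_add_left ((hmeas F hF).const_mul _), lintegral_const_mul _ (hmeas F hF),
          lintegral_const_mul' _ _ (by simp), lintegral_const_mul' _ _ hVtop,
          lintegral_setLIntegral_ball hr hF, lintegral_setLIntegral_ball hr (hG.pow_const 2),
          sq V, mul_assoc V V]

/-- The truncated mean-field fluctuations are controlled by the `L ^ (1 + s / d)` norm. -/
theorem lintegral_min_scaleMeasure_le [Nontrivial E] {s : ℝ} (hs : 0 < s)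
    (hsd : s < Module.finrank ℝ E) {f : E → ℝ} (hf : Measurable f) (hf0 : ∀ x, 0 ≤ f x) :
    ∫⁻ p, min (∫⁻ x in Metric.ball p.2 p.1, ENNReal.ofReal (f x))
        ((∫⁻ x in Metric.ball p.2 p.1, ENNReal.ofReal (f x)) ^ 2) ∂(scaleMeasure E s) ≤
      2 * (volume (Metric.ball (0 : E) 1) * ENNReal.ofReal (1 / s) +
        volume (Metric.ball (0 : E) 1) ^ 2 * ENNReal.ofReal (1 / (Module.finrank ℝ E - s))) *
        ∫⁻ x, ENNReal.ofReal (f x ^ (1 + s / Module.finrank ℝ E)) := by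
  set d := Module.finrank ℝ E with hd
  have hd0 : 0 < d := Module.finrank_pos
  set ω := volume (Metric.ball (0 : E) 1)
  -- At density `r^(-d)` a ball of radius `r` has mass of order one, which is where `m` and `m²`
  -- cross.
  let F : ℝ → E → ℝ≥0∞ := fun r x => if r ^ (-(d : ℝ)) < f x then ENNReal.ofReal (f x) else 0
  let G : ℝ → E → ℝ≥0∞ := fun r x => if r ^ (-(d : ℝ)) < f x then 0 else ENNReal.ofReal (f x)
  have hset : MeasurableSet {q : ℝ × E | q.1 ^ (-(d : ℝ)) < f q.2} :=
    measurableSet_lt (by fun_prop) (by fun_prop)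
  have hF : Measurable (Function.uncurry F) :=
    Measurable.ite hset (by fun_prop) measurable_const
  have hG : Measurable (Function.uncurry G) :=
    Measurable.ite hset measurable_const (by fun_prop)
  have hFG : ∀ r x, ENNReal.ofReal (f x) = F r x + G r x := fun r x => by
    simp only [F, G]; split_ifs <;> simp
  have hFr : ∀ r, Measurable (F r) := fun r => hF.comp measurable_prodMk_left
  have hGr : ∀ r, Measurable (G r) := fun r => hG.comp measurable_prodMk_left
  have hmass : Measurable fun p : ℝ × E =>
      ∫⁻ x in Metric.ball p.2 p.1, ENNReal.ofReal (f x) := by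
    have hm : Measurable (Function.uncurry fun (p : ℝ × E) (x : E) =>
        ballInd p x * ENNReal.ofReal (f x)) :=
      measurable_ballInd.mul (by fun_prop)
    convert hm.lintegral_prod_right' (ν := volume) using 2 with p
    rw [← lintegral_indicator measurableSet_ball]
    refine lintegral_congr fun x => ?_
    simp [ballInd, Set.indicator]
  have hhigh : ∫⁻ r in Set.Ioi (0 : ℝ), ENNReal.ofReal (r ^ (-s - 1)) * ∫⁻ x, F r x ≤
      ENNReal.ofReal (1 / s) * ∫⁻ x, ENNReal.ofReal (f x ^ (1 + s / d)) := by
    rw [← lintegral_const_mul _ (by fun_prop)]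
    simp_rw [fun r => (lintegral_const_mul (ENNReal.ofReal (r ^ (-s - 1))) (hFr r)
      (μ := volume)).symm]
    rw [lintegral_lintegral_swap
      (Measurable.mul (f := fun q : ℝ × E => ENNReal.ofReal (q.1 ^ (-s - 1))) (by fun_prop)
        hF).aemeasurable]
    exact lintegral_mono fun x => lintegral_threshold_high hd0 hs (hf0 x)
  have hlow : ∫⁻ r in Set.Ioi (0 : ℝ), ENNReal.ofReal (r ^ ((d : ℝ) - s - 1)) *
      ∫⁻ x, G r x ^ 2 ≤
      ENNReal.ofReal (1 / (d - s)) * ∫⁻ x, ENNReal.ofReal (f x ^ (1 + s / d)) := by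
    rw [← lintegral_const_mul _ (by fun_prop)]
    simp_rw [fun r => (lintegral_const_mul (ENNReal.ofReal (r ^ ((d : ℝ) - s - 1)))
      ((hGr r).pow_const 2) (μ := volume)).symm]
    rw [lintegral_lintegral_swap
      (Measurable.mul (f := fun q : ℝ × E => ENNReal.ofReal (q.1 ^ ((d : ℝ) - s - 1)))
        (by fun_prop) (hG.pow_const 2)).aemeasurable]
    exact lintegral_mono fun x => lintegral_threshold_low hd0 hsd (hf0 x)
  have hIF : Measurable fun r => ∫⁻ x, F r x := hF.lintegral_prod_right'
  have hIG : Measurable fun r => ∫⁻ x, G r x ^ 2 := (hG.pow_const 2).lintegral_prod_right'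
  rw [lintegral_scaleMeasure s (hmass.min (hmass.pow_const 2)), ← hd]
  calc _ ≤ ∫⁻ r in Set.Ioi (0 : ℝ),
        (2 * ω * (ENNReal.ofReal (r ^ (-s - 1)) * ∫⁻ x, F r x) +
          2 * ω ^ 2 * (ENNReal.ofReal (r ^ ((d : ℝ) - s - 1)) * ∫⁻ x, G r x ^ 2)) := by
        refine setLIntegral_mono' measurableSet_Ioi fun r hr => ?_
        have hr : 0 < r := hr
        refine (mul_le_mul_right (lintegral_min_setLIntegral_ball_le hr.le (hFr r) (hGr r)
          (hFG r)) _).trans (le_of_eq ?_)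
        rw [← hd]
        have e1 : ENNReal.ofReal (r ^ (-s - 1)) =
            ENNReal.ofReal (r ^ (-(d : ℝ) - s - 1)) * ENNReal.ofReal (r ^ d) := by
          rw [← ENNReal.ofReal_mul (by positivity), ← Real.rpow_natCast, ← Real.rpow_add hr]
          congr 2
          ring
        have e2 : ENNReal.ofReal (r ^ ((d : ℝ) - s - 1)) =
            ENNReal.ofReal (r ^ (-(d : ℝ) - s - 1)) * ENNReal.ofReal (r ^ d) ^ 2 := by
          rw [← ENNReal.ofReal_pow (by positivity), ← ENNReal.ofReal_mul (by positivity),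
            ← pow_mul, ← Real.rpow_natCast, ← Real.rpow_add hr]
          congr 2
          push_cast
          ring
        rw [e1, e2]
        ring
    _ = 2 * ω * (∫⁻ r in Set.Ioi (0 : ℝ), ENNReal.ofReal (r ^ (-s - 1)) * ∫⁻ x, F r x) +
        2 * ω ^ 2 * ∫⁻ r in Set.Ioi (0 : ℝ), ENNReal.ofReal (r ^ ((d : ℝ) - s - 1)) *
          ∫⁻ x, G r x ^ 2 := by
        rw [lintegral_add_left (by fun_prop), lintegral_const_mul _ (by fun_prop),
          lintegral_const_mul _ (by fun_prop)]
    _ ≤ 2 * ω * (ENNReal.ofReal (1 / s) * ∫⁻ x, ENNReal.ofReal (f x ^ (1 + s / d))) +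
        2 * ω ^ 2 * (ENNReal.ofReal (1 / (d - s)) *
          ∫⁻ x, ENNReal.ofReal (f x ^ (1 + s / d))) := by
        gcongr
    _ = _ := by ring

end Fluctuation

/-! ### The Lieb–Oxford bound with a constant uniform in `s`. -/

section Riesz

variable {E : Type*} [NormedAddCommGroup E] [InnerProductSpace ℝ E] [FiniteDimensional ℝ E]
  [MeasurableSpace E] [BorelSpace E]

/-- The normalisation is at least `2^(-d) ω / s`, with `ω` the unit ball volume, so its inverse
costs at most `2^d s / ω`. Then `s ≤ d`, and both `1/s` and `1/(d - s)` are at most `1/ε`. -/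
theorem inv_ballKernel_mul_le [Nontrivial E] {s ε : ℝ} (hε : 0 < ε) (hs : ε ≤ s)
    (hsd : s ≤ Module.finrank ℝ E - ε) {e : E} (he : ‖e‖ = 1) :
    (ballKernel s 0 e)⁻¹ * (2 * (volume (Metric.ball (0 : E) 1) * ENNReal.ofReal (1 / s) +
        volume (Metric.ball (0 : E) 1) ^ 2 * ENNReal.ofReal (1 / (Module.finrank ℝ E - s)))) ≤
      ENNReal.ofReal (2 * 2 ^ Module.finrank ℝ E * Module.finrank ℝ E *
        (1 + volume.real (Metric.ball (0 : E) 1)) / ε) := by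
  set d := Module.finrank ℝ E
  set ω := volume.real (Metric.ball (0 : E) 1) with hω
  have hωv : volume (Metric.ball (0 : E) 1) = ENNReal.ofReal ω :=
    (ENNReal.ofReal_toReal measure_ball_lt_top.ne).symm
  have hωpos : 0 < ω :=
    ENNReal.toReal_pos (Metric.measure_ball_pos volume _ one_pos).ne' measure_ball_lt_top.ne
  have hs0 : 0 < s := hε.trans_le hs
  have hd0 : (0 : ℝ) < d := by linarith
  have hκ := le_ballKernel_of_norm_eq_one hs0 he
  rw [hωv, ← ENNReal.ofReal_mul (by positivity)] at hκ
  have hinv := ENNReal.inv_le_inv.2 hκ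
  rw [← ENNReal.ofReal_inv_of_pos (by positivity)] at hinv
  have hds : 0 < (d : ℝ) - s := by linarith
  rw [hωv, ← ENNReal.ofReal_pow hωpos.le, ← ENNReal.ofReal_mul hωpos.le,
    ← ENNReal.ofReal_mul (by positivity), ← ENNReal.ofReal_add (by positivity) (by positivity),
    ← ENNReal.ofReal_ofNat, ← ENNReal.ofReal_mul (by positivity)]
  refine (mul_le_mul_left hinv _).trans ?_
  rw [← ENNReal.ofReal_mul (by positivity)]
  apply ENNReal.ofReal_le_ofReal
  have h1 : 1 / s ≤ 1 / ε := one_div_le_one_div_of_le hε hs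
  have h2 : 1 / ((d : ℝ) - s) ≤ 1 / ε := one_div_le_one_div_of_le hε (by linarith)
  have h3 : s ≤ d := by linarith
  calc ((1 / 2) ^ d / s * ω)⁻¹ * (2 * (ω * (1 / s) + ω ^ 2 * (1 / ((d : ℝ) - s))))
      = 2 * 2 ^ d * s * (1 / s + ω * (1 / ((d : ℝ) - s))) := by
        rw [one_div_pow]
        field_simp
    _ ≤ 2 * 2 ^ d * d * (1 / ε + ω * (1 / ε)) := by gcongr
    _ = _ := by ring

/-- The Lieb–Oxford inequality for the Riesz interaction, together with the finiteness of the
mean-field energy. -/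
theorem sq_mul_meanField_edist_rpow_le [Nontrivial E] {s ε : ℝ} (hε : 0 < ε) (hs : ε ≤ s)
    (hsd : s ≤ Module.finrank ℝ E - ε) {μ : Measure E} [IsProbabilityMeasure μ] {ρ : E → ℝ}
    (hρ : Measurable ρ) (hρ0 : ∀ x, 0 ≤ ρ x)
    (hμ : μ = volume.withDensity fun x => ENNReal.ofReal (ρ x)) :
    meanField (fun x y : E => edist x y ^ (-s)) μ ≤
        ENNReal.ofReal (2 * 2 ^ Module.finrank ℝ E * Module.finrank ℝ E *
          (1 + volume.real (Metric.ball (0 : E) 1)) / ε) *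
          ∫⁻ x, ENNReal.ofReal (ρ x ^ (1 + s / Module.finrank ℝ E)) ∧
      ∀ N : ℝ, 0 ≤ N →
        ENNReal.ofReal N ^ 2 * meanField (fun x y : E => edist x y ^ (-s)) μ ≤
          gcCost (fun x y : E => edist x y ^ (-s)) N μ +
          ENNReal.ofReal (2 * 2 ^ Module.finrank ℝ E * Module.finrank ℝ E *
            (1 + volume.real (Metric.ball (0 : E) 1)) / ε) *
            ∫⁻ x, ENNReal.ofReal ((N * ρ x) ^ (1 + s / Module.finrank ℝ E)) := by
  obtain ⟨e, he⟩ := exists_norm_eq E zero_le_one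
  have hs0 : 0 < s := hε.trans_le hs
  set κ := ballKernel s 0 e
  have hκtop : κ ≠ ⊤ := (ballKernel_lt_top_of_norm_eq_one hs0 he).ne
  have hκ0 : κ ≠ 0 := by
    refine (lt_of_lt_of_le ?_ (le_ballKernel_of_norm_eq_one hs0 he)).ne'
    exact ENNReal.mul_pos (ENNReal.ofReal_pos.2 (by positivity)).ne'
      (Metric.measure_ball_pos volume _ one_pos).ne'
  have hc : ∀ x y : E, edist x y ^ (-s) =
      ∫⁻ p, ballInd p x * ballInd p y ∂(κ⁻¹ • scaleMeasure E s) := fun x y => by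
    rw [lintegral_smul_measure]
    change _ = κ⁻¹ * ballKernel s x y
    rw [ballKernel_eq_mul_edist_rpow hs0 he, ← mul_assoc, ENNReal.inv_mul_cancel hκ0 hκtop,
      one_mul]
  have hball : ∀ (N : ℝ), 0 ≤ N → ∀ p : ℝ × E, ENNReal.ofReal N * ∫⁻ x, ballInd p x ∂μ =
      ∫⁻ x in Metric.ball p.2 p.1, ENNReal.ofReal (N * ρ x) := fun N hN p => by
    rw [lintegral_ballInd, hμ, withDensity_apply _ measurableSet_ball,
      ← lintegral_const_mul _ (by fun_prop)]
    simp_rw [ENNReal.ofReal_mul hN]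
  have hmain : ∀ N : ℝ, 0 ≤ N →
      ∫⁻ p, min (ENNReal.ofReal N * ∫⁻ x, ballInd p x ∂μ)
        ((ENNReal.ofReal N * ∫⁻ x, ballInd p x ∂μ) ^ 2) ∂(κ⁻¹ • scaleMeasure E s) ≤
      ENNReal.ofReal (2 * 2 ^ Module.finrank ℝ E * Module.finrank ℝ E *
          (1 + volume.real (Metric.ball (0 : E) 1)) / ε) *
          ∫⁻ x, ENNReal.ofReal ((N * ρ x) ^ (1 + s / Module.finrank ℝ E)) := fun N hN => by
    simp_rw [hball N hN]
    rw [lintegral_smul_measure]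
    refine (mul_le_mul_right (lintegral_min_scaleMeasure_le hs0 (by linarith)
      (hρ.const_mul N) fun x => mul_nonneg hN (hρ0 x)) _).trans ?_
    rw [← mul_assoc]
    exact mul_le_mul_left (inv_ballKernel_mul_le hε hs hsd he) _
  refine ⟨?_, fun N hN => ?_⟩
  -- At `N = 1` the mean is the probability of a ball, hence at most one, so the minimum is the
  -- square and its integral is the mean-field energy itself.
  · have h := hmain 1 zero_le_one
    simp only [one_mul, ENNReal.ofReal_one] at h
    refine le_trans (le_of_eq ?_) h
    rw [meanField_eq_lintegral_sq measurable_ballInd hc]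
    refine lintegral_congr fun p => (min_eq_right ?_).symm
    rw [lintegral_ballInd, sq]
    exact mul_le_of_le_one_left' prob_le_one
  · exact (sq_mul_meanField_le_gcCost_add measurable_ballInd ballInd_le_one hc N μ).trans
      (add_le_add_right (hmain N hN) _)

end Riesz

/-- Finiteness of `T` forces that of `F`, so the extended difference is a genuine real one and the
estimate can be divided by `N^p`. -/
theorem rpow_mul_sub_bounds {F T : ℝ≥0∞} {N p C I : ℝ} (hN : 0 < N) (hT : T ≠ ⊤) (hFT : F ≤ T)
    (hCI : 0 ≤ C * I) (hTF : T ≤ F + ENNReal.ofReal (C * (N ^ p * I))) :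
    ((-C * I : ℝ) : EReal) ≤ ((N ^ (-p) : ℝ) : EReal) * ((F : EReal) - (T : EReal)) ∧
      ((N ^ (-p) : ℝ) : EReal) * ((F : EReal) - (T : EReal)) ≤ 0 := by
  have hF : F ≠ ⊤ := ne_top_of_le_ne_top hT hFT
  lift T to NNReal using hT
  lift F to NNReal using hF
  have hNp : 0 < N ^ p := Real.rpow_pos_of_pos hN p
  have hnn : 0 ≤ C * (N ^ p * I) := by
    have := mul_nonneg hNp.le hCI
    linarith
  have h1 : (F : ℝ) ≤ T := by exact_mod_cast hFT
  have h2 : (T : ℝ) ≤ F + C * (N ^ p * I) := by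
    rw [ENNReal.ofReal, ← ENNReal.coe_add, ENNReal.coe_le_coe, ← NNReal.coe_le_coe] at hTF
    simpa [Real.coe_toNNReal _ hnn] using hTF
  have e1 : ((F : ℝ≥0∞) : EReal) = ((F : ℝ) : EReal) := rfl
  have e2 : ((T : ℝ≥0∞) : EReal) = ((T : ℝ) : EReal) := rfl
  rw [e1, e2, ← EReal.coe_sub, ← EReal.coe_mul, ← EReal.coe_zero, EReal.coe_le_coe_iff,
    EReal.coe_le_coe_iff, Real.rpow_neg hN.le]
  have hinv : 0 < (N ^ p)⁻¹ := inv_pos.2 hNp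
  refine ⟨?_, mul_nonpos_of_nonneg_of_nonpos hinv.le (by linarith)⟩
  rw [inv_mul_eq_div, le_div_iff₀ hNp]
  linarith

end RieszOT

/-! ### Conclusion for both energies on Euclidean space. -/

theorem lemmaC1 (d : ℕ) (ε : ℝ) (hε : 0 < ε) (hεd : ε < (d : ℝ) / 2) :
    ∃ cLO : ℝ, cLO < 0 ∧
      ∀ s : ℝ, ε ≤ s → s ≤ (d : ℝ) - ε →
      ∀ (μ : Measure (EuclideanSpace ℝ (Fin d))) [IsProbabilityMeasure μ]
        (ρ : EuclideanSpace ℝ (Fin d) → ℝ), (∀ x, 0 ≤ ρ x) →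
        MemLp ρ (ENNReal.ofReal (1 + s / d)) volume →
        μ = volume.withDensity (fun x => ENNReal.ofReal (ρ x)) →
        (∀ N : ℕ, 2 ≤ N →
          ((cLO * ∫ x, ρ x ^ (1 + s / d) : ℝ) : EReal) ≤
              (((N : ℝ) ^ (-1 - s / d) : ℝ) : EReal) *
                RieszOT.exc (RieszOT.rieszCost d s) N μ ∧
            (((N : ℝ) ^ (-1 - s / d) : ℝ) : EReal) *
                RieszOT.exc (RieszOT.rieszCost d s) N μ ≤ 0) ∧
        (∀ N : ℝ, 2 ≤ N →
          ((cLO * ∫ x, ρ x ^ (1 + s / d) : ℝ) : EReal) ≤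
              ((N ^ (-1 - s / d) : ℝ) : EReal) *
                RieszOT.gcExc (RieszOT.rieszCost d s) N μ ∧
            ((N ^ (-1 - s / d) : ℝ) : EReal) *
                RieszOT.gcExc (RieszOT.rieszCost d s) N μ ≤ 0) := by
  have hd0 : (0 : ℝ) < d := by linarith
  have hd1 : 0 < d := by exact_mod_cast hd0
  have : Nonempty (Fin d) := ⟨⟨0, hd1⟩⟩
  set C : ℝ := 2 * 2 ^ d * d *
    (1 + volume.real (Metric.ball (0 : EuclideanSpace ℝ (Fin d)) 1)) / ε with hC
  have hCpos : 0 < C := by positivity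
  refine ⟨-C, by linarith, fun s hs hsd μ _ ρ hρ0 hρ hμ => ?_⟩
  have hs0 : 0 < s := hε.trans_le hs
  have hp0 : 0 < 1 + s / d := by positivity
  set p : ℝ := 1 + s / d with hp
  have hneg : -1 - s / d = -p := by rw [hp]; ring
  simp only [hneg]
  -- Cutting at a height needs a measurable density that is nonnegative everywhere; `MemLp` provides
  -- measurability only up to null sets.
  obtain ⟨ρ', hρ'm, hρ'0, hae⟩ : ∃ ρ' : EuclideanSpace ℝ (Fin d) → ℝ, Measurable ρ' ∧
      (∀ x, 0 ≤ ρ' x) ∧ ρ =ᵐ[volume] ρ' := by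
    have hm := hρ.1.aemeasurable
    refine ⟨fun x => max (hm.mk ρ x) 0, hm.measurable_mk.max measurable_const,
      fun x => le_max_right _ _, ?_⟩
    filter_upwards [hm.ae_eq_mk] with x hx
    rw [← hx, max_eq_left (hρ0 x)]
  have hμ' : μ = volume.withDensity fun x => ENNReal.ofReal (ρ' x) := by
    rw [hμ]
    exact withDensity_congr_ae (hae.fun_comp ENNReal.ofReal)
  set I : ℝ := ∫ x, ρ x ^ p with hI
  have hint : Integrable (fun x => ρ x ^ p) := by
    have h := hρ.integrable_norm_rpow (by simpa using hp0) ENNReal.ofReal_ne_top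
    rw [ENNReal.toReal_ofReal hp0.le] at h
    simpa only [Real.norm_of_nonneg (hρ0 _)] using h
  have hI0 : 0 ≤ I := integral_nonneg fun x => Real.rpow_nonneg (hρ0 x) _
  have hIlint : ∫⁻ x, ENNReal.ofReal (ρ' x ^ p) = ENNReal.ofReal I := by
    rw [hI, ofReal_integral_eq_lintegral_ofReal hint
      (.of_forall fun x => Real.rpow_nonneg (hρ0 x) _)]
    refine lintegral_congr_ae ?_
    filter_upwards [hae] with x hx
    rw [hx]
  have hscale : ∀ N : ℝ, 0 ≤ N →
      ∫⁻ x, ENNReal.ofReal ((N * ρ' x) ^ p) = ENNReal.ofReal (N ^ p * I) := fun N hN => by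
    simp_rw [Real.mul_rpow hN (hρ'0 _), ENNReal.ofReal_mul (Real.rpow_nonneg hN _)]
    rw [lintegral_const_mul' _ _ ENNReal.ofReal_ne_top, hIlint]
  have hfin : Module.finrank ℝ (EuclideanSpace ℝ (Fin d)) = d := finrank_euclideanSpace_fin
  obtain ⟨hMF, hlow⟩ := RieszOT.sq_mul_meanField_edist_rpow_le hε hs (by rw [hfin]; exact hsd)
    hρ'm hρ'0 hμ'
  rw [hfin, ← hC, ← hp, hIlint] at hMF
  change RieszOT.meanField (RieszOT.rieszCost d s) μ ≤ _ at hMF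
  have hMFtop : RieszOT.meanField (RieszOT.rieszCost d s) μ ≠ ⊤ :=
    ne_top_of_le_ne_top (ENNReal.mul_ne_top ENNReal.ofReal_ne_top ENNReal.ofReal_ne_top) hMF
  have hlow' : ∀ N : ℝ, 0 ≤ N →
      ENNReal.ofReal N ^ 2 * RieszOT.meanField (RieszOT.rieszCost d s) μ ≤
        RieszOT.gcCost (RieszOT.rieszCost d s) N μ + ENNReal.ofReal (C * (N ^ p * I)) :=
      fun N hN => by
    have h := hlow N hN
    rw [hfin, ← hC, ← hp, hscale N hN, ← ENNReal.ofReal_mul hCpos.le] at h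
    exact h
  have hcm : Measurable (Function.uncurry (RieszOT.rieszCost d s)) :=
    measurable_edist.pow_const _
  have hCI : 0 ≤ C * I := mul_nonneg hCpos.le hI0
  refine ⟨fun N hN => ?_, fun N hN => ?_⟩
  · refine RieszOT.rpow_mul_sub_bounds (by positivity)
      (ENNReal.mul_ne_top (by simp) hMFtop) ((RieszOT.otCost_le hcm N μ).trans ?_) hCI ?_
    · gcongr
      exact_mod_cast (Nat.sub_le (N * N) N).trans_eq (sq N).symm
    · have h := hlow' N N.cast_nonneg
      rw [ENNReal.ofReal_natCast] at h
      exact h.trans (add_le_add_left (RieszOT.gcCost_le_otCost _ N μ) _)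
  · have hN0 : 0 < N := by linarith
    exact RieszOT.rpow_mul_sub_bounds hN0
      (ENNReal.mul_ne_top (ENNReal.pow_ne_top ENNReal.ofReal_ne_top) hMFtop)
      (RieszOT.gcCost_le hcm hN0.le μ) hCI (hlow' N hN0.le)
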